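/- **Setting.** Let $\mathbb{H}$ be the quaternions with conjugation $q\mapsto\bar q$, and let $i,j\in\mathbb{H}$ be orthogonal purely imaginary quaternions of norm $1$. Put $\mathbb{C}_i=\mathbb{R}+\mathbb{R}i$ and $\mathbb{T}_i=\{z\in\mathbb{C}_i:|z|=1\}$. Let $\mu_i$ be an $\mathbb{H}$-valued (countably additive) Borel measure on $\mathbb{T}_i$ that is *$q$-positive*: $\mu_i=\mu^{(1)}+\mu^{(2)}j$ with $\mu^{(1)}$ a finite positive measure and $\mu^{(2)}$ a $\mathbb{C}_i$-valued measure with $\int e^{in\theta}\,d\mu^{(2)}=-\int e^{-in\theta}\,d\mu^{(2)}$ for all $n\in\mathbb{Z}$, and the matrix-valued measure $$\begin{bmatrix}\mu^{(1)}&\mu^{(2)}\\ \overline{\mu^{(2)}}&\nu\end{bmatrix}$$ is positive semidefinite, where $\nu$ is the measure with $\int e^{in\theta}\,d\nu=\int e^{-in\theta}\,d\mu^{(1)}$ for all $n$. Let $c_n=\int e^{in\theta}\,d\mu_i(\theta)$, $n\in\mathbb{Z}$, be its moments, and assume that $\mu_i$ is *non-trivial*: for every $N\ge 0$ the Toeplitz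 matrix $T_N=[c_{l-k}]_{k,l=0}^N$ (row $k$, column $l$) is positive definite, i.e. $\xi^*T_N\xi>0$ for all $0\ne\xi\in\mathbb{H}^{N+1}$. **Orthonormal polynomials.** On polynomials $\varphi(p)=\sum_k\varphi_kp^k$, $\psi(p)=\sum_k\psi_kp^k$ with coefficients on the left, let $\langle\varphi,\psi\rangle_L=\sum_{k,l}\varphi_k\,c_{k-l}\,\overline{\psi_l}$; on polynomials $\varphi(p)=\sum_kp^k\varphi_k$, $\psi(p)=\sum_kp^k\psi_k$ with coefficients on the right, let $\langle\varphi,\psi\rangle_R=\sum_{k,l}\overline{\psi_l}\,c_{k-l}\,\varphi_k$. Let $(\psi_n^L)_{n\ge0}$ and $(\psi_n^R)_{n\ge0}$ be the orthonormal polynomials obtained from $1,p,p^2,\dots$ by the Gram–Schmidt algorithm with respect to $\langle\cdot,\cdot\rangle_L$ (coefficients on the left) and $\langle\cdot,\cdot\rangle_R$ (coefficients on the right), respectively. The reverse of a polynomial $\psi(p)=\sum_{k=0}^n\psi_kp^k$ of degree $n$ is $\psi^{\#}(p)=\sum_{k=0}^np^{n-k}\,\overline{\psi_k}$, and the reverse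 of $\varphi(p)=\sum_{k=0}^np^k\varphi_k$ is $\varphi^{\#}(p)=\sum_{k=0}^n\overline{\varphi_k}\,p^{n-k}$. **Verblunsky coefficients.** For power series $\sum_kp^kf_k$ with coefficients on the right, let $\star$ be the product given by convolution of the coefficients, and $f^{-\star}$ the inverse for it. Let $F(p)=1+2\sum_{k\ge1}p^k\,c_0^{-1}c_{-k}$ (so $c_0=1$ for a probability measure, and then $F(z)=\int(1+ze^{-i\theta})(1-ze^{-i\theta})^{-1}\,d\mu_i(\theta)$ for $z\in\mathbb{C}_i$, $|z|<1$), let $f_0$ be given by $p\star f_0=(F-1)\star(F+1)^{-\star}$, and let $$\gamma_n=f_n(0),\qquad f_{n+1}=p^{-1}\star(f_n-\gamma_n)\star(1-\overline{\gamma_n}\star f_n)^{-\star},\qquad n\ge0 .$$ **Theorem.** For every $n\ge0$ one has $|\gamma_n|<1$ and, with $r_n=\sqrt{1-|\gamma_n|^2}$, for all $p\in\mathbb{H}$, $$\psi_n^L(p)\,p-r_n\,\psi_{n+1}^L(p)=\overline{\gamma_n}\,\psi_n^{R,\#}(p),\qquad p\,\psi_n^R(p)-\psi_{n+1}^R(p)\,r_n=\psi_n^{L,\#}(p)\,\overline{\gamma_n}.$$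 -/

import Mathlib

open MeasureTheory
open scoped Quaternion Polynomial PowerSeries Matrix

noncomputable section

namespace QuatOPUC

/-- The quaternions carry their Borel σ-algebra. -/
instance instMeasurableSpaceQuaternion : MeasurableSpace ℍ[ℝ] := borel ℍ[ℝ]

instance instBorelSpaceQuaternion : BorelSpace ℍ[ℝ] := ⟨rfl⟩

/-! ### Imaginary units, slices, circles -/

/-- The sphere `𝕊` of purely imaginary quaternions of norm one. -/
def imagUnits : Set ℍ[ℝ] := {q | q.re = 0 ∧ ‖q‖ = 1}

/-- The plane `ℂ_i = ℝ + ℝ i` inside the quaternions. -/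
def slicePlane (i : ℍ[ℝ]) : Set ℍ[ℝ] := {q | ∃ a b : ℝ, q = (a : ℍ[ℝ]) + (b : ℍ[ℝ]) * i}

/-- The unit circle `𝕋_i` of the plane `ℂ_i`. -/
def sliceCircle (i : ℍ[ℝ]) : Set ℍ[ℝ] := {q | q ∈ slicePlane i ∧ ‖q‖ = 1}

/-! ### Positivity of quaternionic matrices and sequences -/

/-- `A` is positive semidefinite: `ξ* A ξ` is a nonnegative real number for all `ξ ∈ ℍⁿ`.
(For a matrix with entries in one plane `ℂ_i` this is the usual complex notion.) -/
def IsPosSemidef {m : ℕ} (A : Matrix (Fin m) (Fin m) ℍ[ℝ]) : Prop :=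
  ∀ ξ : Fin m → ℍ[ℝ], ∃ r : ℝ, 0 ≤ r ∧ star ξ ⬝ᵥ (A *ᵥ ξ) = (r : ℍ[ℝ])

/-- `A` is positive definite: `ξ* A ξ` is a positive real number for all nonzero `ξ ∈ ℍⁿ`. -/
def IsPosDef {m : ℕ} (A : Matrix (Fin m) (Fin m) ℍ[ℝ]) : Prop :=
  ∀ ξ : Fin m → ℍ[ℝ], ξ ≠ 0 → ∃ r : ℝ, 0 < r ∧ star ξ ⬝ᵥ (A *ᵥ ξ) = (r : ℍ[ℝ])

/-- The Toeplitz matrix `T_n(c)`, whose entry in row `k` and column `l` is `c_{l - k}`. -/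
def toeplitz (c : ℤ → ℍ[ℝ]) (n : ℕ) : Matrix (Fin (n + 1)) (Fin (n + 1)) ℍ[ℝ] :=
  Matrix.of fun k l => c ((l : ℤ) - (k : ℤ))

/-- A non-trivial positive definite sequence: all its Toeplitz matrices are positive definite. -/
def IsNontrivialPositive (c : ℤ → ℍ[ℝ]) : Prop := ∀ n : ℕ, IsPosDef (toeplitz c n)

/-! ### `q`-positive measures -/

/-- The moments `c_n = ∫ e^{i n θ} dμ(θ)` of a quaternion-valued measure on `𝕋_i`; the point
`e^{i θ}` of `𝕋_i` is the integration variable, and the integrand stands to the left of `μ`. -/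
def moment {i : ℍ[ℝ]} (μ : VectorMeasure (sliceCircle i) ℍ[ℝ]) (n : ℤ) : ℍ[ℝ] :=
  ∫ᵛ z, (z : ℍ[ℝ]) ^ n ∂[ContinuousLinearMap.mul ℝ ℍ[ℝ]; μ]

/-- `μ` is `q`-positive with respect to `i, j`: it is `μ₁ + μ₂ j` with `μ₁` a (finite) positive
measure and `μ₂` a `ℂ_i`-valued measure whose moments are odd, and the `2 × 2` matrix-valued
measure with rows `(μ₁, μ₂)` and `(conj μ₂, ν)` is positive semidefinite, where `ν` is the measure
whose moments are those of `μ₁` in reversed order. -/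
def IsQPositive (i j : ℍ[ℝ]) (μ : VectorMeasure (sliceCircle i) ℍ[ℝ]) : Prop :=
  ∃ (μ₁ ν : Measure (sliceCircle i)) (μ₂ : VectorMeasure (sliceCircle i) ℍ[ℝ]),
    IsFiniteMeasure μ₁ ∧ IsFiniteMeasure ν ∧
    (∀ E, μ₂ E ∈ slicePlane i) ∧
    (∀ E, MeasurableSet E → μ E = (μ₁.real E : ℍ[ℝ]) + μ₂ E * j) ∧
    (∀ n : ℤ, ∫ z, (z : ℍ[ℝ]) ^ n ∂ν = ∫ z, (z : ℍ[ℝ]) ^ (-n) ∂μ₁) ∧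
    (∀ n : ℤ, moment μ₂ n = -moment μ₂ (-n)) ∧
    ∀ E, MeasurableSet E →
      IsPosSemidef !![(μ₁.real E : ℍ[ℝ]), μ₂ E; star (μ₂ E), (ν.real E : ℍ[ℝ])]

/-! ### Slice hyperholomorphic polynomials

Polynomials of both kinds are given by their coefficients, as elements of `ℍ[ℝ][X]`. The functions
they define on the quaternions have the coefficients on the right of the powers of the variable
in the left-slice hyperholomorphic case, and on the left in the right-slice hyperholomorphic case. -/

/-- The left-slice hyperholomorphic polynomial function `p ↦ ∑ pᵏ φ_k`. -/
def evalL (φ : ℍ[ℝ][X]) (p : ℍ[ℝ]) : ℍ[ℝ] :=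
  ∑ k ∈ Finset.range (φ.natDegree + 1), p ^ k * φ.coeff k

/-- The right-slice hyperholomorphic polynomial function `p ↦ ∑ φ_k pᵏ`. -/
def evalR (φ : ℍ[ℝ][X]) (p : ℍ[ℝ]) : ℍ[ℝ] :=
  ∑ k ∈ Finset.range (φ.natDegree + 1), φ.coeff k * p ^ k

/-- The reverse polynomial: if `φ` has degree `n`, its `k`-th coefficient is `conj φ_{n - k}`. It
turns left- into right-slice hyperholomorphic polynomials and conversely, see `evalR_rev` and
`evalL_rev`. -/
def rev (φ : ℍ[ℝ][X]) : ℍ[ℝ][X] :=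
  ∑ k ∈ Finset.range (φ.natDegree + 1),
    Polynomial.monomial k (star (φ.coeff (φ.natDegree - k)))

/-- The coefficient vector `(φ_0, …, φ_N)`. -/
def coeffVec (N : ℕ) (φ : ℍ[ℝ][X]) : Fin (N + 1) → ℍ[ℝ] := fun k => φ.coeff k

/-- The form `⟨φ, ψ⟩_R = ψ̂* T_N(c) φ̂ = ∑ conj ψ_l c_{k - l} φ_k` on left-slice hyperholomorphic
polynomials. -/
def formR (c : ℤ → ℍ[ℝ]) (φ ψ : ℍ[ℝ][X]) : ℍ[ℝ] :=
  let N := max φ.natDegree ψ.natDegree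
  star (coeffVec N ψ) ⬝ᵥ (toeplitz c N *ᵥ coeffVec N φ)

/-- The form `⟨φ, ψ⟩_L = ∑ φ_k c_{k - l} conj ψ_l` on right-slice hyperholomorphic polynomials. -/
def formL (c : ℤ → ℍ[ℝ]) (φ ψ : ℍ[ℝ][X]) : ℍ[ℝ] :=
  let N := max φ.natDegree ψ.natDegree
  coeffVec N φ ⬝ᵥ ((toeplitz c N)ᵀ *ᵥ star (coeffVec N ψ))

/-- The left-orthonormal polynomials `ψ_n^L` (right-slice hyperholomorphic, coefficients on the
left of the variable): Gram-Schmidt applied to `1, p, p², …` and the form `⟨·,·⟩_L`. -/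
def psiL (c : ℤ → ℍ[ℝ]) (n : ℕ) : ℍ[ℝ][X] :=
  let v : ℍ[ℝ][X] := Polynomial.X ^ n -
    ∑ m : Fin n, Polynomial.C (formL c (Polynomial.X ^ n) (psiL c m)) * psiL c m
  (Real.sqrt (formL c v v).re)⁻¹ • v
termination_by n
decreasing_by all_goals exact m.isLt

/-- The right-orthonormal polynomials `ψ_n^R` (left-slice hyperholomorphic, coefficients on the
right of the variable): Gram-Schmidt applied to `1, p, p², …` and the form `⟨·,·⟩_R`. -/
def psiR (c : ℤ → ℍ[ℝ]) (n : ℕ) : ℍ[ℝ][X] :=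
  let v : ℍ[ℝ][X] := Polynomial.X ^ n -
    ∑ m : Fin n, psiR c m * Polynomial.C (formR c (Polynomial.X ^ n) (psiR c m))
  (Real.sqrt (formR c v v).re)⁻¹ • v
termination_by n
decreasing_by all_goals exact m.isLt

/-! ### Schur algorithm and Verblunsky coefficients

A left-slice hyperholomorphic function `f(p) = ∑ pᵏ f_k` on the unit ball is given by its power
series `∑ f_k Xᵏ`; the `⋆`-product of such functions is the product of these power series. -/

/-- The Herglotz function `F(p) = 1 + 2 ∑_{k ≥ 1} pᵏ c_{-k}` of a sequence with `c_0 = 1`, that is,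
`F(z) = ∫ (1 + z e^{-i θ}) (1 - z e^{-i θ})⁻¹ dμ(θ)` on the unit disc of `ℂ_i` when the `c_n` are
the moments of `μ`. Sequences with `c_0 ≠ 1` are normalised first. -/
def herglotz (c : ℤ → ℍ[ℝ]) : ℍ[ℝ]⟦X⟧ :=
  PowerSeries.mk fun k => if k = 0 then 1 else 2 * ((c 0)⁻¹ * c (-(k : ℤ)))

/-- `p⁻¹ ⋆ (g(p) - g(0))`. -/
def stripX (g : ℍ[ℝ]⟦X⟧) : ℍ[ℝ]⟦X⟧ := PowerSeries.mk fun k => PowerSeries.coeff (k + 1) g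

/-- The Schur function `f` of `c`, with `p ⋆ f = (F - 1) ⋆ (F + 1)^{-⋆}`, i.e.
`F = (1 + p ⋆ f) ⋆ (1 - p ⋆ f)^{-⋆}`. -/
def schurFunction (c : ℤ → ℍ[ℝ]) : ℍ[ℝ]⟦X⟧ :=
  stripX ((herglotz c - 1) * Ring.inverse (herglotz c + 1))

/-- One step of the Schur algorithm,
`f ↦ p⁻¹ ⋆ (f - f(0)) ⋆ (1 - conj f(0) ⋆ f)^{-⋆}`. -/
def schurStep (f : ℍ[ℝ]⟦X⟧) : ℍ[ℝ]⟦X⟧ :=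
  stripX ((f - PowerSeries.C (PowerSeries.constantCoeff f)) *
    Ring.inverse (1 - PowerSeries.C (star (PowerSeries.constantCoeff f)) * f))

/-- The Verblunsky coefficients `γ_n = f_n(0)`, where `f_0` is the Schur function of `c` and
`f_{n+1}` arises from `f_n` by a step of the Schur algorithm. -/
def verblunsky (c : ℤ → ℍ[ℝ]) (n : ℕ) : ℍ[ℝ] :=
  PowerSeries.constantCoeff (schurStep^[n] (schurFunction c))

/-! ### Consistency of the definitions -/

theorem evalL_eq_sum_range (φ : ℍ[ℝ][X]) (p : ℍ[ℝ]) (N : ℕ) (hN : φ.natDegree ≤ N) :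
    evalL φ p = ∑ k ∈ Finset.range (N + 1), p ^ k * φ.coeff k := by
  unfold evalL
  refine Finset.sum_subset (fun k hk => ?_) (fun k _ hk => ?_)
  · simp only [Finset.mem_range] at hk ⊢; omega
  · rw [Polynomial.coeff_eq_zero_of_natDegree_lt, mul_zero]
    simp only [Finset.mem_range] at hk; omega

theorem evalR_eq_sum_range (φ : ℍ[ℝ][X]) (p : ℍ[ℝ]) (N : ℕ) (hN : φ.natDegree ≤ N) :
    evalR φ p = ∑ k ∈ Finset.range (N + 1), φ.coeff k * p ^ k := by
  unfold evalR
  refine Finset.sum_subset (fun k hk => ?_) (fun k _ hk => ?_)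
  · simp only [Finset.mem_range] at hk ⊢; omega
  · rw [Polynomial.coeff_eq_zero_of_natDegree_lt, zero_mul]
    simp only [Finset.mem_range] at hk; omega

theorem coeff_rev (φ : ℍ[ℝ][X]) (k : ℕ) :
    (rev φ).coeff k = if k ≤ φ.natDegree then star (φ.coeff (φ.natDegree - k)) else 0 := by
  simp only [rev, Polynomial.finsetSum_coeff, Polynomial.coeff_monomial]
  rw [Finset.sum_ite_eq' (Finset.range (φ.natDegree + 1)) k]
  simp

theorem natDegree_rev_le (φ : ℍ[ℝ][X]) : (rev φ).natDegree ≤ φ.natDegree := by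
  rw [Polynomial.natDegree_le_iff_coeff_eq_zero]
  intro k hk
  rw [coeff_rev, if_neg (by omega)]

/-- `φ^#(p) = conj (φ (1 / conj p)) pⁿ` for left-slice hyperholomorphic `φ` of degree `n`. -/
theorem evalR_rev (φ : ℍ[ℝ][X]) (p : ℍ[ℝ]) (hp : p ≠ 0) :
    evalR (rev φ) p = star (evalL φ (star p)⁻¹) * p ^ φ.natDegree := by
  rw [evalR_eq_sum_range _ p _ (natDegree_rev_le φ), evalL, star_sum, Finset.sum_mul,
    ← Finset.sum_range_reflect]
  refine Finset.sum_congr rfl fun k hk => ?_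
  have hk' : k ≤ φ.natDegree := by simp only [Finset.mem_range] at hk; omega
  have e : φ.natDegree + 1 - 1 - k = φ.natDegree - k := by omega
  rw [e, coeff_rev, if_pos (by omega), Nat.sub_sub_self hk', star_mul, star_pow, star_inv₀,
    star_star, mul_assoc, inv_pow, pow_sub₀ _ hp hk', (Commute.refl p).pow_pow _ _ |>.inv_right₀.eq]

/-- `ψ^#(p) = pⁿ conj (ψ (1 / conj p))` for right-slice hyperholomorphic `ψ` of degree `n`. -/
theorem evalL_rev (φ : ℍ[ℝ][X]) (p : ℍ[ℝ]) (hp : p ≠ 0) :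
    evalL (rev φ) p = p ^ φ.natDegree * star (evalR φ (star p)⁻¹) := by
  rw [evalL_eq_sum_range _ p _ (natDegree_rev_le φ), evalR, star_sum, Finset.mul_sum,
    ← Finset.sum_range_reflect]
  refine Finset.sum_congr rfl fun k hk => ?_
  have hk' : k ≤ φ.natDegree := by simp only [Finset.mem_range] at hk; omega
  have e : φ.natDegree + 1 - 1 - k = φ.natDegree - k := by omega
  rw [e, coeff_rev, if_pos (by omega), Nat.sub_sub_self hk', star_mul, star_pow, star_inv₀,
    star_star, ← mul_assoc, inv_pow, pow_sub₀ _ hp hk']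

end QuatOPUC

end

/-!
Only the moments `c` of the measure matter, and of these only that all Toeplitz matrices are
positive definite. This makes `c` Hermitian, `c_{-n} = conj c_n`, with `c_0` real and positive.

Let `γ` be the Verblunsky coefficients from the Schur algorithm, and let the polynomials `Φ_n`,
`Φ_n^*` be given by the Szegő recursion
`Φ_{n+1} = X Φ_n - conj γ_n Φ_n^*`, `Φ_{n+1}^* = Φ_n^* - γ_n X Φ_n`, starting from `1, 1`.
In terms of the generating functions
`u_n = ∑ p^m ⟨Φ_n, X^{m+n}⟩_L` and `v_n = ∑ p^m ⟨Φ_n^*, X^{m+n+1}⟩_L` the recursion reads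
`u_{n+1} = u_n - conj γ_n ⋆ v_n`, `p ⋆ v_{n+1} = v_n - γ_n ⋆ u_n`, which is the Schur algorithm for
the quotient `v_n ⋆ u_n^{-⋆}`, and `v_0 ⋆ u_0^{-⋆}` is the Schur function of `c`. Hence
`f_n ⋆ u_n = v_n` for all `n`, and its constant term `⟨Φ_n^*, X^{n+1}⟩ = γ_n ⟨Φ_n, X^n⟩` is what
the induction needs to see that `Φ_n` is orthogonal to `1, …, X^{n-1}` and `Φ_n^*` to `X, …, X^n`
(`szegoOrthogonal_verblunsky`). The squared norms are `E_n = c_0 ∏_{k<n} (1 - |γ_k|²)`; being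
positive, they give `|γ_n| < 1`.

A sequence of monic orthogonal polynomials is determined up to normalisation by the Gram-Schmidt
algorithm (`IsMonicOrthogonal.psiL_eq`), so `ψ_n^L = Φ_n / √E_n`. Reflecting `Φ_n^*` produces the
monic left orthogonal polynomials of the conjugate sequence, and the right orthonormal polynomials
of `c` are those with conjugated coefficients, so `(ψ_n^R)^# = Φ_n^* / √E_n`. After division by
`√E_n`, the two lines of the Szegő recursion are the two claimed identities.
-/

noncomputable section

namespace QuatOPUC

variable {c : ℤ → ℍ[ℝ]}

/-! ### Positive definite sequences -/

theorem toeplitz_form_eq (N : ℕ) (ξ : Fin (N + 1) → ℍ[ℝ]) :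
    star ξ ⬝ᵥ (toeplitz c N *ᵥ ξ) =
      ∑ k : Fin (N + 1), ∑ l : Fin (N + 1), star (ξ k) * (c ((l : ℤ) - k) * ξ l) := by
  simp [dotProduct, Matrix.mulVec, toeplitz, Finset.mul_sum]

theorem IsNontrivialPositive.exists_re (hc : IsNontrivialPositive c) :
    ∃ r : ℝ, 0 < r ∧ c 0 = (r : ℍ[ℝ]) := by
  obtain ⟨r, hr, h⟩ := hc 0 (fun _ => 1) (fun h => one_ne_zero (congrFun h 0))
  refine ⟨r, hr, ?_⟩
  rw [toeplitz_form_eq] at h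
  simpa using h

/-- A positive definite sequence is Hermitian. The off-diagonal part of the form at `e₀ + b eₙ` is
`c n * b + star b * c (-n)`, and reality of it for `b = 1` and for one imaginary unit `b` already
forces the symmetry. -/
theorem IsNontrivialPositive.star_eq (hc : IsNontrivialPositive c) (n : ℤ) :
    star (c n) = c (-n) := by
  obtain ⟨r₀, -, h0⟩ := hc.exists_re
  have key : ∀ m : ℕ, star (c m) = c (-m) := by
    intro m
    rcases Nat.eq_zero_or_pos m with rfl | hm
    · simp [h0]
    have real : ∀ b : ℍ[ℝ], ∃ s : ℝ, c m * b + star b * c (-m) = (s : ℍ[ℝ]) := by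
      intro b
      have h0m : (0 : Fin (m + 1)) ≠ Fin.last m := by
        intro h; have := congrArg Fin.val h; simp at this; omega
      obtain ⟨r, -, h⟩ := hc m (Pi.single 0 1 + Pi.single (Fin.last m) b) (by
        intro h
        have := congrFun h 0
        simp [h0m] at this)
      refine ⟨r - r₀ - r₀ * ‖b‖ ^ 2, ?_⟩
      rw [toeplitz_form_eq] at h
      simp only [Pi.add_apply, star_add, Pi.single_apply, mul_add, add_mul,
        Finset.sum_add_distrib] at h
      simp [apply_ite star, h0] at h
      have hb : star b * ((r₀ : ℍ[ℝ]) * b) = ((r₀ * ‖b‖ ^ 2 : ℝ) : ℍ[ℝ]) := by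
        rw [← mul_assoc, ← (Quaternion.coe_commutes r₀ (star b)), mul_assoc,
          Quaternion.star_mul_self, Quaternion.normSq_eq_norm_mul_self]
        push_cast; rw [sq]
      push_cast at hb ⊢
      rw [← h, ← hb]
      abel
    obtain ⟨s, hs⟩ := real 1
    obtain ⟨b, b0, b1, b2, b3⟩ : ∃ b : ℍ[ℝ], b.re = 0 ∧ b.imI = 1 ∧ b.imJ = 0 ∧ b.imK = 0 :=
      ⟨⟨0, 1, 0, 0⟩, rfl, rfl, rfl, rfl⟩
    obtain ⟨t, ht⟩ := real b
    have e1 := congrArg QuaternionAlgebra.imI hs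
    have e2 := congrArg QuaternionAlgebra.imJ hs
    have e3 := congrArg QuaternionAlgebra.imK hs
    have e4 := congrArg QuaternionAlgebra.imI ht
    simp [b0, b1, b2, b3] at e1 e2 e3 e4
    ext <;> simp <;> linarith
  obtain ⟨m, rfl | rfl⟩ := n.eq_nat_or_neg
  · exact key m
  · rw [← key m, star_star, neg_neg]

/-! ### Pairing with the powers of the variable -/

/-- The left-linear functional `φ ↦ ⟨φ, X^m⟩_L = ∑ φ_k c_{k - m}`, with `m` any integer. -/
def pairing (c : ℤ → ℍ[ℝ]) (m : ℤ) : ℍ[ℝ][X] →ₗ[ℍ[ℝ]] ℍ[ℝ] :=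
  Polynomial.lsum fun k => LinearMap.toSpanSingleton ℍ[ℝ] ℍ[ℝ] (c (k - m))

theorem pairing_eq_sum_range (m : ℤ) (φ : ℍ[ℝ][X]) {N : ℕ} (hN : φ.natDegree ≤ N) :
    pairing c m φ = ∑ k ∈ Finset.range (N + 1), φ.coeff k * c (k - m) := by
  simp only [pairing, Polynomial.lsum_apply]
  rw [Polynomial.sum_over_range' _ (by simp) (N + 1) (by omega)]
  simp

theorem pairing_C_mul (m : ℤ) (a : ℍ[ℝ]) (φ : ℍ[ℝ][X]) :
    pairing c m (Polynomial.C a * φ) = a * pairing c m φ := by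
  rw [Polynomial.C_mul', map_smul, smul_eq_mul]

theorem pairing_one (m : ℤ) : pairing c m 1 = c (-m) := by
  rw [pairing_eq_sum_range m 1 (N := 0) (by simp)]
  simp

theorem pairing_X_mul (m : ℤ) (φ : ℍ[ℝ][X]) :
    pairing c m (Polynomial.X * φ) = pairing c (m - 1) φ := by
  rw [pairing_eq_sum_range m _ (N := φ.natDegree + 1)
    (Polynomial.natDegree_mul_le.trans (by simp [add_comm])),
    pairing_eq_sum_range (m - 1) φ le_rfl, Finset.sum_range_succ']
  simp only [Polynomial.coeff_X_mul, Polynomial.coeff_X_mul_zero, zero_mul, add_zero]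
  refine Finset.sum_congr rfl fun k _ => ?_
  congr 2
  push_cast
  ring

theorem formL_eq_sum_range (φ ψ : ℍ[ℝ][X]) {N : ℕ} (hN : ψ.natDegree ≤ N) :
    formL c φ ψ = ∑ l ∈ Finset.range (N + 1), pairing c l φ * star (ψ.coeff l) := by
  have h : formL c φ ψ = ∑ l ∈ Finset.range (max φ.natDegree ψ.natDegree + 1),
      pairing c l φ * star (ψ.coeff l) := by
    rw [← Fin.sum_univ_eq_sum_range fun l => pairing c (l : ℤ) φ * star (ψ.coeff l)]
    simp only [pairing_eq_sum_range _ φ (le_max_left φ.natDegree ψ.natDegree)]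
    simp only [← Fin.sum_univ_eq_sum_range fun k => φ.coeff k * c ((k : ℤ) - _), formL, dotProduct,
      Matrix.mulVec, toeplitz, coeffVec, Finset.mul_sum, Finset.sum_mul]
    rw [Finset.sum_comm]
    simp [mul_assoc, coeffVec]
  -- Raising the upper limit beyond the degree of `ψ` only adds zero terms.
  have aux : ∀ M, ψ.natDegree ≤ M →
      ∑ l ∈ Finset.range (M + 1), pairing c l φ * star (ψ.coeff l) =
        ∑ l ∈ Finset.range (ψ.natDegree + 1), pairing c l φ * star (ψ.coeff l) := by
    intro M hM
    symm
    refine Finset.sum_subset (fun k hk => ?_) (fun k _ hk => ?_)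
    · simp only [Finset.mem_range] at hk ⊢; omega
    · rw [Polynomial.coeff_eq_zero_of_natDegree_lt, star_zero, mul_zero]
      simp only [Finset.mem_range] at hk; omega
  rw [h, aux _ (le_max_right _ _), aux _ hN]

theorem formL_sub_left (φ₁ φ₂ ψ : ℍ[ℝ][X]) :
    formL c (φ₁ - φ₂) ψ = formL c φ₁ ψ - formL c φ₂ ψ := by
  simp only [formL_eq_sum_range _ ψ le_rfl, map_sub, sub_mul, Finset.sum_sub_distrib]

theorem formL_C_mul_left (a : ℍ[ℝ]) (φ ψ : ℍ[ℝ][X]) :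
    formL c (Polynomial.C a * φ) ψ = a * formL c φ ψ := by
  simp only [formL_eq_sum_range _ ψ le_rfl, pairing_C_mul, Finset.mul_sum, mul_assoc]

theorem formL_C_mul_right (a : ℍ[ℝ]) (φ ψ : ℍ[ℝ][X]) :
    formL c φ (Polynomial.C a * ψ) = formL c φ ψ * star a := by
  rw [formL_eq_sum_range _ _ (Polynomial.natDegree_C_mul_le a ψ), formL_eq_sum_range _ ψ le_rfl]
  simp [Finset.sum_mul, mul_assoc]

/-- The form is Hermitian. -/
theorem star_formL (hs : ∀ n, star (c n) = c (-n)) (φ ψ : ℍ[ℝ][X]) :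
    star (formL c φ ψ) = formL c ψ φ := by
  simp only [formL_eq_sum_range _ _ (le_refl _), pairing_eq_sum_range _ _ (le_refl _), star_sum,
    star_mul, star_star, hs, Finset.sum_mul]
  rw [Finset.sum_comm]
  simp [mul_assoc]

/-! ### Szegő recursion -/

/-- The polynomials `(Φ_n, Φ_n^*)` that the Szegő recursion with parameters `γ` produces from
`(1, 1)`. The first is the candidate for the monic left orthogonal polynomial, the second for the
reverse of the monic right orthogonal polynomial. -/
def szegoPair (γ : ℕ → ℍ[ℝ]) : ℕ → ℍ[ℝ][X] × ℍ[ℝ][X]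
  | 0 => (1, 1)
  | n + 1 =>
    (Polynomial.X * (szegoPair γ n).1 - Polynomial.C (star (γ n)) * (szegoPair γ n).2,
      (szegoPair γ n).2 - Polynomial.C (γ n) * (Polynomial.X * (szegoPair γ n).1))

/-- The monic polynomials `Φ_n` of the Szegő recursion. -/
def szego (γ : ℕ → ℍ[ℝ]) (n : ℕ) : ℍ[ℝ][X] := (szegoPair γ n).1

/-- The reversed polynomials `Φ_n^*` of the Szegő recursion. -/
def szegoStar (γ : ℕ → ℍ[ℝ]) (n : ℕ) : ℍ[ℝ][X] := (szegoPair γ n).2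

variable (γ : ℕ → ℍ[ℝ])

theorem szego_succ (n : ℕ) : szego γ (n + 1) =
    Polynomial.X * szego γ n - Polynomial.C (star (γ n)) * szegoStar γ n := rfl

theorem szegoStar_succ (n : ℕ) : szegoStar γ (n + 1) =
    szegoStar γ n - Polynomial.C (γ n) * (Polynomial.X * szego γ n) := rfl

theorem natDegree_szego_le (n : ℕ) :
    (szego γ n).natDegree ≤ n ∧ (szegoStar γ n).natDegree ≤ n := by
  induction n with
  | zero => simp [szego, szegoStar, szegoPair]
  | succ n ih =>
    have hX : (Polynomial.X * szego γ n).natDegree ≤ n + 1 :=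
      Polynomial.natDegree_mul_le.trans (by simp; omega)
    rw [szego_succ, szegoStar_succ]
    exact ⟨(Polynomial.natDegree_sub_le_of_le hX
        ((Polynomial.natDegree_C_mul_le _ _).trans (ih.2.trans n.le_succ))).trans (by simp),
      (Polynomial.natDegree_sub_le_of_le (ih.2.trans n.le_succ)
        ((Polynomial.natDegree_C_mul_le _ _).trans hX)).trans (by simp)⟩

theorem coeff_szego_self (n : ℕ) : (szego γ n).coeff n = 1 := by
  induction n with
  | zero => simp [szego, szegoPair]
  | succ n ih =>
    rw [szego_succ, Polynomial.coeff_sub, Polynomial.coeff_X_mul, ih, Polynomial.coeff_C_mul,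
      Polynomial.coeff_eq_zero_of_natDegree_lt
        (Nat.lt_succ_of_le (natDegree_szego_le γ n).2), mul_zero, sub_zero]

theorem coeff_szegoStar_zero (n : ℕ) : (szegoStar γ n).coeff 0 = 1 := by
  induction n with
  | zero => simp [szegoStar, szegoPair]
  | succ n ih => simp [szegoStar_succ, ih]

theorem natDegree_szego (n : ℕ) : (szego γ n).natDegree = n :=
  le_antisymm (natDegree_szego_le γ n).1
    (Polynomial.le_natDegree_of_ne_zero (by simp [coeff_szego_self]))

theorem natDegree_X_mul_szego_le (n : ℕ) : (Polynomial.X * szego γ n).natDegree ≤ n + 1 :=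
  Polynomial.natDegree_mul_le.trans (by simp [natDegree_szego, add_comm])

/-- The squared norm `E_n = c_0 ∏_{k < n} (1 - |γ_k|²)` of the `n`-th monic orthogonal
polynomial. -/
def sqNorm (c : ℤ → ℍ[ℝ]) (γ : ℕ → ℍ[ℝ]) (n : ℕ) : ℝ :=
  (c 0).re * ∏ k ∈ Finset.range n, (1 - ‖γ k‖ ^ 2)

theorem sqNorm_succ (n : ℕ) : sqNorm c γ (n + 1) = sqNorm c γ n * (1 - ‖γ n‖ ^ 2) := by
  rw [sqNorm, sqNorm, Finset.prod_range_succ, mul_assoc]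

/-! ### Orthogonality along the Szegő recursion -/

/-- Positivity of the Toeplitz matrices in terms of `⟨·,·⟩_L`. The form `⟨φ, φ⟩_L` is the Toeplitz
form at the vector with entries `conj φ_{N - k}`: the coefficients have to be reversed, since the
order of multiplication puts `c_{k - l}` where the Toeplitz matrix has `c_{l - k}`. -/
theorem IsNontrivialPositive.formL_self_pos (hc : IsNontrivialPositive c) {φ : ℍ[ℝ][X]}
    (hφ : φ ≠ 0) : ∃ r : ℝ, 0 < r ∧ formL c φ φ = (r : ℍ[ℝ]) := by
  set N := φ.natDegree with hN
  obtain ⟨r, hr, h⟩ := hc N (fun k => star (φ.coeff (Fin.rev k : Fin (N + 1)))) (by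
    intro h
    have := congrFun h 0
    simp [hN] at this
    exact hφ this)
  refine ⟨r, hr, Eq.trans ?_ h⟩
  rw [toeplitz_form_eq, formL_eq_sum_range φ φ hN.ge,
    ← Fin.sum_univ_eq_sum_range fun l => pairing c (l : ℤ) φ * star (φ.coeff l)]
  simp only [pairing_eq_sum_range _ φ hN.ge,
    ← Fin.sum_univ_eq_sum_range fun k => φ.coeff k * c ((k : ℤ) - _), star_star, Finset.sum_mul]
  rw [Finset.sum_comm]
  refine Fintype.sum_equiv Fin.revPerm _ _ fun k => Fintype.sum_equiv Fin.revPerm _ _ fun l => ?_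
  simp only [Fin.revPerm_apply, Fin.rev_rev, mul_assoc, Fin.val_rev]
  congr 3
  omega

/-- The two polynomials of degree at most `n` are orthogonal to `1, …, X^{n-1}` and to
`X, …, X^n` respectively, and `E_n` is the value of both remaining pairings. -/
structure SzegoOrthogonal (c : ℤ → ℍ[ℝ]) (γ : ℕ → ℍ[ℝ]) (n : ℕ) : Prop where
  szego : ∀ l < n, pairing c l (szego γ n) = 0
  szegoStar : ∀ l < n, pairing c (l + 1 : ℕ) (szegoStar γ n) = 0
  szego_self : pairing c n (QuatOPUC.szego γ n) = (sqNorm c γ n : ℍ[ℝ])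
  szegoStar_zero : pairing c 0 (QuatOPUC.szegoStar γ n) = (sqNorm c γ n : ℍ[ℝ])

variable {γ} {n : ℕ}

theorem SzegoOrthogonal.sqNorm_pos (h : SzegoOrthogonal c γ n) (hc : IsNontrivialPositive c) :
    0 < sqNorm c γ n := by
  obtain ⟨r, hr, e⟩ := hc.formL_self_pos (φ := QuatOPUC.szego γ n) (by
    intro h0; have := coeff_szego_self γ n; simp [h0] at this)
  rw [formL_eq_sum_range _ _ (natDegree_szego γ n).le, Finset.sum_range_succ,
    Finset.sum_eq_zero, h.szego_self, coeff_szego_self] at e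
  · simp only [star_one, mul_one, zero_add, Quaternion.coe_inj] at e
    exact e ▸ hr
  · intro l hl
    rw [h.szego l (Finset.mem_range.1 hl), zero_mul]

/-- Both sides of `⟨X Φ_n, Φ_n^*⟩ = conj ⟨Φ_n^*, X Φ_n⟩` collapse to one term, because `X Φ_n` and
`Φ_n^*` are orthogonal to `X, …, X^n`. -/
theorem SzegoOrthogonal.star_pairing (h : SzegoOrthogonal c γ n)
    (hs : ∀ n, star (c n) = c (-n)) :
    pairing c (-1) (QuatOPUC.szego γ n) =
      star (pairing c (n + 1 : ℕ) (QuatOPUC.szegoStar γ n)) := by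
  have e := star_formL hs (QuatOPUC.szegoStar γ n) (Polynomial.X * QuatOPUC.szego γ n)
  rw [formL_eq_sum_range _ _ (natDegree_X_mul_szego_le γ n), Finset.sum_range_succ,
    Finset.sum_range_succ', formL_eq_sum_range _ _ (natDegree_szego_le γ n).2,
    Finset.sum_range_succ', Finset.sum_eq_zero, Finset.sum_eq_zero] at e
  · simpa [coeff_szego_self, coeff_szegoStar_zero, pairing_X_mul, Polynomial.coeff_X_mul] using
      e.symm
  · intro l hl
    rw [pairing_X_mul, Nat.cast_succ, add_sub_cancel_right, h.szego l (Finset.mem_range.1 hl),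
      zero_mul]
  · intro l hl
    rw [h.szegoStar l (Finset.mem_range.1 hl), zero_mul]

/-- The Szegő recursion preserves orthogonality as soon as `γ_n` is the ratio that makes
`Φ_{n+1}^*` orthogonal to `X^{n+1}`. -/
theorem SzegoOrthogonal.succ (h : SzegoOrthogonal c γ n) (hs : ∀ n, star (c n) = c (-n))
    (hγ : pairing c (n + 1 : ℕ) (QuatOPUC.szegoStar γ n) = γ n * (sqNorm c γ n : ℍ[ℝ])) :
    SzegoOrthogonal c γ (n + 1) := by
  have h1 := h.star_pairing hs
  rw [hγ, star_mul, Quaternion.star_coe, (Quaternion.coe_commutes _ _)] at h1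
  have hE : ((sqNorm c γ (n + 1) : ℝ) : ℍ[ℝ]) =
      sqNorm c γ n - γ n * star (γ n) * sqNorm c γ n := by
    rw [sqNorm_succ, Quaternion.self_mul_star, Quaternion.normSq_eq_norm_mul_self,
      ← Quaternion.coe_mul, ← Quaternion.coe_sub, Quaternion.coe_inj]
    ring
  have hE' : ((sqNorm c γ (n + 1) : ℝ) : ℍ[ℝ]) =
      sqNorm c γ n - star (γ n) * γ n * sqNorm c γ n := by
    rw [hE, Quaternion.self_mul_star, Quaternion.star_mul_self]
  constructor
  · intro l hl
    rw [szego_succ, map_sub, pairing_X_mul, pairing_C_mul]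
    cases l with
    | zero => simp [h1, h.szegoStar_zero]
    | succ l =>
      rw [h.szegoStar l (by omega), Nat.cast_succ, add_sub_cancel_right, h.szego l (by omega),
        mul_zero, sub_zero]
  · intro l hl
    rw [szegoStar_succ, map_sub, pairing_C_mul, pairing_X_mul]
    rcases Nat.lt_succ_iff_lt_or_eq.1 hl with hl | rfl
    · rw [h.szegoStar l hl, Nat.cast_succ, add_sub_cancel_right, h.szego l hl, mul_zero, sub_zero]
    · rw [hγ, Nat.cast_succ, add_sub_cancel_right, h.szego_self, sub_self]
  · rw [szego_succ, map_sub, pairing_X_mul, pairing_C_mul, hγ, Nat.cast_succ, add_sub_cancel_right,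
      h.szego_self, hE', mul_assoc]
  · rw [szegoStar_succ, map_sub, pairing_C_mul, pairing_X_mul, h.szegoStar_zero, zero_sub, h1, hE,
      mul_assoc]

/-! ### The Schur algorithm -/

theorem X_mul_stripX {g : ℍ[ℝ]⟦X⟧} (hg : PowerSeries.constantCoeff g = 0) :
    PowerSeries.X * stripX g = g := by
  ext1 k
  cases k with
  | zero => simp [hg]
  | succ k => simp [PowerSeries.coeff_succ_X_mul, stripX]

/-- If `f ⋆ u = v`, then a step of the Schur algorithm turns `f` into the quotient of `p⁻¹(v - γu)`
by `u - conj γ ⋆ v`, where `γ = f(0)`. -/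
theorem schurStep_mul {f u v w : ℍ[ℝ]⟦X⟧} {a : ℍ[ℝ]} (ha : PowerSeries.constantCoeff f = a)
    (ha1 : ‖a‖ < 1) (hf : f * u = v)
    (hw : PowerSeries.X * w = v - PowerSeries.C a * u) :
    schurStep f * (u - PowerSeries.C (star a) * v) = w := by
  have hunit : IsUnit (1 - PowerSeries.C (star a) * f) := by
    rw [PowerSeries.isUnit_iff_constantCoeff, isUnit_iff_ne_zero]
    simp only [map_sub, map_one, map_mul, PowerSeries.constantCoeff_C, ha]
    rw [Quaternion.star_mul_self, Quaternion.normSq_eq_norm_mul_self, sub_ne_zero,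
      ← Quaternion.coe_one, Ne, Quaternion.coe_inj]
    nlinarith [norm_nonneg a]
  rw [← PowerSeries.X_mul_inj, hw, ← mul_assoc, schurStep, ha, X_mul_stripX (by simp [ha]), ← hf,
    show u - PowerSeries.C (star a) * (f * u) = (1 - PowerSeries.C (star a) * f) * u by
      rw [sub_mul, one_mul, mul_assoc],
    ← mul_assoc, mul_assoc (f - _), Ring.inverse_mul_cancel _ hunit, mul_one, sub_mul]

/-- The generating function `∑ p^m ⟨Φ_n, X^{m+n}⟩`. -/
def szegoSeries (c : ℤ → ℍ[ℝ]) (γ : ℕ → ℍ[ℝ]) (n : ℕ) : ℍ[ℝ]⟦X⟧ :=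
  PowerSeries.mk fun m => pairing c (m + n : ℕ) (szego γ n)

/-- The generating function `∑ p^m ⟨Φ_n^*, X^{m+n+1}⟩`. -/
def szegoStarSeries (c : ℤ → ℍ[ℝ]) (γ : ℕ → ℍ[ℝ]) (n : ℕ) : ℍ[ℝ]⟦X⟧ :=
  PowerSeries.mk fun m => pairing c (m + n + 1 : ℕ) (szegoStar γ n)

theorem szegoSeries_succ : szegoSeries c γ (n + 1) =
    szegoSeries c γ n - PowerSeries.C (star (γ n)) * szegoStarSeries c γ n := by
  ext1 m
  rw [map_sub, PowerSeries.coeff_C_mul]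
  simp only [szegoSeries, szegoStarSeries, PowerSeries.coeff_mk, szego_succ, map_sub,
    pairing_X_mul, pairing_C_mul, ← add_assoc, Nat.cast_succ, add_sub_cancel_right]

theorem X_mul_szegoStarSeries_succ (h : SzegoOrthogonal c γ n)
    (hγ : pairing c (n + 1 : ℕ) (szegoStar γ n) = γ n * (sqNorm c γ n : ℍ[ℝ])) :
    PowerSeries.X * szegoStarSeries c γ (n + 1) =
      szegoStarSeries c γ n - PowerSeries.C (γ n) * szegoSeries c γ n := by
  ext1 m
  rw [map_sub, PowerSeries.coeff_C_mul]
  cases m with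
  | zero => simp [szegoSeries, szegoStarSeries, h.szego_self, ← hγ]
  | succ m =>
    rw [PowerSeries.coeff_succ_X_mul]
    simp only [szegoSeries, szegoStarSeries, PowerSeries.coeff_mk, szegoStar_succ, map_sub,
      pairing_X_mul, pairing_C_mul]
    have e1 : m + (n + 1) + 1 = m + 1 + n + 1 := by omega
    rw [e1, Nat.cast_succ (m + 1 + n), add_sub_cancel_right]

/-- The Schur function of `c` is `v_0 / u_0`, since `F + 1 = 2 c_0⁻¹ ∑ p^m c_{-m}` and
`F - 1 = 2 c_0⁻¹ p ⋆ ∑ p^m c_{-m-1}`. -/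
theorem schurFunction_mul (hc : IsNontrivialPositive c) :
    schurFunction c * szegoSeries c γ 0 = szegoStarSeries c γ 0 := by
  obtain ⟨r, hr, h0⟩ := hc.exists_re
  have hr0 : (r : ℍ[ℝ]) ≠ 0 := by rw [← Quaternion.coe_zero, Ne, Quaternion.coe_inj]; exact hr.ne'
  have h2 : (2 : ℍ[ℝ]) ≠ 0 := by
    rw [show (2 : ℍ[ℝ]) = ((2 : ℝ) : ℍ[ℝ]) by norm_cast, ← Quaternion.coe_zero, Ne,
      Quaternion.coe_inj]
    exact two_ne_zero
  have hu : herglotz c + 1 = PowerSeries.C (2 * (c 0)⁻¹) * szegoSeries c γ 0 := by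
    ext1 m
    rw [map_add, PowerSeries.coeff_C_mul]
    cases m with
    | zero => simp [herglotz, szegoSeries, szego, szegoPair, pairing_one, h0, hr0]; norm_num
    | succ m =>
      simp [herglotz, szegoSeries, szego, szegoPair, pairing_one, PowerSeries.coeff_one, mul_assoc]
  have hv : herglotz c - 1 =
      PowerSeries.C (2 * (c 0)⁻¹) * (PowerSeries.X * szegoStarSeries c γ 0) := by
    ext1 m
    rw [map_sub, PowerSeries.coeff_C_mul]
    cases m with
    | zero => simp [herglotz]
    | succ m =>
      rw [PowerSeries.coeff_succ_X_mul]
      simp [herglotz, szegoStarSeries, szegoStar, szegoPair, pairing_one, PowerSeries.coeff_one,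
        mul_assoc]
  -- `c 0` is real, so the constant series is central.
  have hcomm : ∀ w : ℍ[ℝ]⟦X⟧,
      PowerSeries.C (2 * (c 0)⁻¹) * w = w * PowerSeries.C (2 * (c 0)⁻¹) := by
    intro w
    have : (2 * (c 0)⁻¹ : ℍ[ℝ]) = ((2 * r⁻¹ : ℝ) : ℍ[ℝ]) := by rw [h0]; push_cast; rfl
    ext1 k
    rw [PowerSeries.coeff_C_mul, PowerSeries.coeff_mul_C, this, Quaternion.coe_commutes]
  have hunit : IsUnit (herglotz c + 1) := by
    rw [PowerSeries.isUnit_iff_constantCoeff, isUnit_iff_ne_zero]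
    simpa [herglotz, one_add_one_eq_two] using h2
  have hC : IsUnit (PowerSeries.C (2 * (c 0)⁻¹) : ℍ[ℝ]⟦X⟧) := by
    rw [PowerSeries.isUnit_iff_constantCoeff, isUnit_iff_ne_zero]
    simp [h0, hr0, h2]
  rw [← PowerSeries.X_mul_inj, ← mul_assoc, schurFunction, X_mul_stripX (by simp [herglotz]),
    ← hC.mul_left_inj, mul_assoc, ← hcomm, ← hu, mul_assoc, Ring.inverse_mul_cancel _ hunit,
    mul_one, hv, hcomm]

/-- The Schur iterates are `f_n = v_n / u_n`, for the generating functions of the polynomials that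
the Szegő recursion yields for the Verblunsky coefficients. Comparing constant terms shows that
`γ_n` is the ratio which keeps the recursion orthogonal, so both facts are proved together. -/
theorem szegoOrthogonal_verblunsky (hc : IsNontrivialPositive c) (n : ℕ) :
    SzegoOrthogonal c (verblunsky c) n ∧
      schurStep^[n] (schurFunction c) * szegoSeries c (verblunsky c) n =
        szegoStarSeries c (verblunsky c) n := by
  induction n with
  | zero =>
    obtain ⟨r, -, h0⟩ := hc.exists_re
    refine ⟨⟨by simp, by simp, ?_, ?_⟩, schurFunction_mul hc⟩ <;>
      simp [szego, szegoStar, szegoPair, pairing_one, sqNorm, h0]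
  | succ n ih =>
    obtain ⟨h, hf⟩ := ih
    have hγ : pairing c (n + 1 : ℕ) (szegoStar (verblunsky c) n) =
        verblunsky c n * (sqNorm c (verblunsky c) n : ℍ[ℝ]) := by
      have := congrArg PowerSeries.constantCoeff hf
      rw [map_mul] at this
      simp only [szegoSeries, szegoStarSeries, ← PowerSeries.coeff_zero_eq_constantCoeff_apply,
        PowerSeries.coeff_mk, zero_add, h.szego_self] at this
      rw [← this, PowerSeries.coeff_zero_eq_constantCoeff_apply]
      rfl
    have h' := h.succ hc.star_eq hγ
    have hpos := h'.sqNorm_pos hc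
    rw [sqNorm_succ, mul_pos_iff_of_pos_left (h.sqNorm_pos hc), sub_pos,
      sq_lt_one_iff₀ (norm_nonneg _)] at hpos
    refine ⟨h', ?_⟩
    rw [Function.iterate_succ_apply', szegoSeries_succ]
    exact schurStep_mul rfl hpos hf (X_mul_szegoStarSeries_succ h hγ)

theorem sqNorm_verblunsky_pos (hc : IsNontrivialPositive c) (n : ℕ) :
    0 < sqNorm c (verblunsky c) n :=
  (szegoOrthogonal_verblunsky hc n).1.sqNorm_pos hc

theorem norm_verblunsky_lt_one (hc : IsNontrivialPositive c) (n : ℕ) : ‖verblunsky c n‖ < 1 := by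
  have := sqNorm_verblunsky_pos hc (n + 1)
  rwa [sqNorm_succ, mul_pos_iff_of_pos_left (sqNorm_verblunsky_pos hc n), sub_pos,
    sq_lt_one_iff₀ (norm_nonneg _)] at this

/-! ### Monic orthogonal polynomials and the Gram-Schmidt algorithm -/

theorem real_smul_eq_C_mul (s : ℝ) (φ : ℍ[ℝ][X]) :
    s • φ = Polynomial.C (s : ℍ[ℝ]) * φ := by
  ext1 k
  rw [Polynomial.coeff_smul, Polynomial.coeff_C_mul, Quaternion.coe_mul_eq_smul]

/-- `Φ_n` is monic of degree `n` and orthogonal to `1, …, X^{n-1}` for `⟨·,·⟩_L`, with positive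
squared norm `E_n`. -/
structure IsMonicOrthogonal (c : ℤ → ℍ[ℝ]) (Φ : ℕ → ℍ[ℝ][X]) (E : ℕ → ℝ) : Prop where
  natDegree_le : ∀ n, (Φ n).natDegree ≤ n
  coeff_self : ∀ n, (Φ n).coeff n = 1
  pairing_eq_zero : ∀ n : ℕ, ∀ l < n, pairing c l (Φ n) = 0
  pairing_self : ∀ n : ℕ, pairing c n (Φ n) = (E n : ℍ[ℝ])
  pos : ∀ n, 0 < E n

namespace IsMonicOrthogonal

variable {Φ : ℕ → ℍ[ℝ][X]} {E : ℕ → ℝ}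

theorem formL_eq_zero (h : IsMonicOrthogonal c Φ E) {n : ℕ} {φ : ℍ[ℝ][X]}
    (hφ : φ.natDegree < n) : formL c (Φ n) φ = 0 := by
  rw [formL_eq_sum_range _ _ le_rfl]
  refine Finset.sum_eq_zero fun l hl => ?_
  rw [h.pairing_eq_zero n l (by simp only [Finset.mem_range] at hl; omega), zero_mul]

theorem formL_right (h : IsMonicOrthogonal c Φ E) (hs : ∀ n, star (c n) = c (-n)) {n : ℕ}
    {φ : ℍ[ℝ][X]} (hφ : φ.natDegree ≤ n) : formL c φ (Φ n) = φ.coeff n * (E n : ℍ[ℝ]) := by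
  rw [← star_formL hs, formL_eq_sum_range _ _ hφ, Finset.sum_range_succ, Finset.sum_eq_zero,
    h.pairing_self, zero_add, star_mul, star_star, Quaternion.star_coe]
  intro l hl
  rw [h.pairing_eq_zero n l (Finset.mem_range.1 hl), zero_mul]

/-- Orthogonal expansion of a polynomial of degree less than `n`. -/
theorem eq_sum (h : IsMonicOrthogonal c Φ E) (hs : ∀ n, star (c n) = c (-n)) (n : ℕ)
    (φ : ℍ[ℝ][X]) (hφ : ∀ k, n ≤ k → φ.coeff k = 0) :
    φ = ∑ m ∈ Finset.range n,
      Polynomial.C (formL c φ (Φ m) * ((E m)⁻¹ : ℝ)) * Φ m := by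
  induction n generalizing φ with
  | zero => ext1 k; simp [hφ k]
  | succ n ih =>
    -- Removing the leading coefficient does not affect the pairings with `Φ_m`, `m < n`.
    have key := ih (φ - Polynomial.C (φ.coeff n) * Φ n) fun k hk => by
      rcases hk.eq_or_lt with rfl | hk
      · simp [h.coeff_self]
      · rw [Polynomial.coeff_sub, Polynomial.coeff_C_mul, hφ k hk,
          Polynomial.coeff_eq_zero_of_natDegree_lt ((h.natDegree_le n).trans_lt hk), mul_zero,
          sub_zero]
    have hdeg : φ.natDegree ≤ n :=
      Polynomial.natDegree_le_iff_coeff_eq_zero.2 fun k hk => hφ k hk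
    rw [Finset.sum_range_succ, h.formL_right hs hdeg, mul_assoc, ← Quaternion.coe_mul,
      mul_inv_cancel₀ (h.pos n).ne', Quaternion.coe_one, mul_one, ← sub_eq_iff_eq_add]
    refine key.trans (Finset.sum_congr rfl fun m hm => ?_)
    rw [formL_sub_left, formL_C_mul_left,
      h.formL_eq_zero ((h.natDegree_le m).trans_lt (Finset.mem_range.1 hm)), mul_zero, sub_zero]

/-- Monic orthogonal polynomials are, up to normalisation, the result of the Gram-Schmidt
algorithm: the projection of `X^n` subtracted there is the expansion of `X^n - Φ_n`. -/
theorem psiL_eq (h : IsMonicOrthogonal c Φ E) (hs : ∀ n, star (c n) = c (-n)) (n : ℕ) :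
    psiL c n = (Real.sqrt (E n))⁻¹ • Φ n := by
  induction n using Nat.strong_induction_on with
  | _ n ih =>
    have hv : Polynomial.X ^ n -
        ∑ m : Fin n, Polynomial.C (formL c (Polynomial.X ^ n) (psiL c m)) * psiL c m = Φ n := by
      rw [sub_eq_iff_eq_add', ← sub_eq_iff_eq_add,
        h.eq_sum hs n (Polynomial.X ^ n - Φ n) (fun k hk => ?_), ← Fin.sum_univ_eq_sum_range
          fun m => Polynomial.C (formL c (Polynomial.X ^ n - Φ n) (Φ m) * ((E m)⁻¹ : ℝ)) * Φ m]
      · refine Finset.sum_congr rfl fun m _ => ?_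
        have hE : (((E m)⁻¹ : ℝ) : ℍ[ℝ]) =
            ((Real.sqrt (E m))⁻¹ : ℝ) * ((Real.sqrt (E m))⁻¹ : ℝ) := by
          rw [← Quaternion.coe_mul, ← mul_inv, Real.mul_self_sqrt (h.pos m).le]
        rw [ih m m.2, formL_sub_left, h.formL_eq_zero ((h.natDegree_le m).trans_lt m.2), sub_zero,
          real_smul_eq_C_mul, formL_C_mul_right, Quaternion.star_coe, ← mul_assoc,
          ← Polynomial.C_mul, mul_assoc, ← hE]
      · rcases hk.eq_or_lt with rfl | hk
        · simp [h.coeff_self]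
        · rw [Polynomial.coeff_sub, Polynomial.coeff_X_pow, if_neg hk.ne',
            Polynomial.coeff_eq_zero_of_natDegree_lt ((h.natDegree_le n).trans_lt hk), sub_zero]
    rw [psiL]
    simp only [hv]
    rw [h.formL_right hs (h.natDegree_le n), h.coeff_self, one_mul, Quaternion.re_coe]

end IsMonicOrthogonal

/-! ### Conjugation of coefficients -/

/-- The polynomial with conjugated coefficients. It exchanges left and right coefficients. -/
def conjCoeff (φ : ℍ[ℝ][X]) : ℍ[ℝ][X] :=
  ∑ k ∈ Finset.range (φ.natDegree + 1), Polynomial.monomial k (star (φ.coeff k))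

theorem coeff_conjCoeff (φ : ℍ[ℝ][X]) (k : ℕ) : (conjCoeff φ).coeff k = star (φ.coeff k) := by
  simp only [conjCoeff, Polynomial.finsetSum_coeff, Polynomial.coeff_monomial]
  rw [Finset.sum_ite_eq' (Finset.range (φ.natDegree + 1)) k]
  split_ifs with h
  · rfl
  · rw [Polynomial.coeff_eq_zero_of_natDegree_lt, star_zero]
    simp only [Finset.mem_range] at h; omega

theorem conjCoeff_conjCoeff (φ : ℍ[ℝ][X]) : conjCoeff (conjCoeff φ) = φ := by
  ext1 k; simp only [coeff_conjCoeff, star_star]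

theorem natDegree_conjCoeff (φ : ℍ[ℝ][X]) : (conjCoeff φ).natDegree = φ.natDegree := by
  have aux : ∀ χ : ℍ[ℝ][X], (conjCoeff χ).natDegree ≤ χ.natDegree := fun χ =>
    Polynomial.natDegree_le_iff_coeff_eq_zero.2 fun k hk => by
      rw [coeff_conjCoeff, Polynomial.coeff_eq_zero_of_natDegree_lt hk, star_zero]
  exact le_antisymm (aux φ) (by simpa only [conjCoeff_conjCoeff] using aux (conjCoeff φ))

theorem formR_conjCoeff (φ ψ : ℍ[ℝ][X]) :
    formR c (conjCoeff φ) (conjCoeff ψ) = star (formL (fun n => star (c n)) φ ψ) := by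
  simp only [formR, formL]
  rw [natDegree_conjCoeff, natDegree_conjCoeff]
  generalize max φ.natDegree ψ.natDegree = N
  simp only [dotProduct, Matrix.mulVec, Finset.mul_sum, star_sum]
  rw [Finset.sum_comm]
  simp [toeplitz, coeffVec, coeff_conjCoeff, mul_assoc]

/-- Conjugating coefficients turns the right orthonormal polynomials of `c` into the left
orthonormal polynomials of `conj c`. -/
theorem psiR_eq_conjCoeff (n : ℕ) : psiR c n = conjCoeff (psiL (fun n => star (c n)) n) := by
  induction n using Nat.strong_induction_on with
  | _ n ih =>
    have hX : (Polynomial.X ^ n : ℍ[ℝ][X]) = conjCoeff (Polynomial.X ^ n) := by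
      ext1 k; simp [coeff_conjCoeff, Polynomial.coeff_X_pow, apply_ite star]
    have hv : Polynomial.X ^ n -
        ∑ m : Fin n, psiR c m * Polynomial.C (formR c (Polynomial.X ^ n) (psiR c m)) =
        conjCoeff (Polynomial.X ^ n - ∑ m : Fin n, Polynomial.C
          (formL (fun n => star (c n)) (Polynomial.X ^ n) (psiL (fun n => star (c n)) m)) *
            psiL (fun n => star (c n)) m) := by
      ext1 k
      rw [coeff_conjCoeff, Polynomial.coeff_sub, Polynomial.coeff_sub, star_sub,
        Polynomial.finsetSum_coeff, Polynomial.finsetSum_coeff, star_sum]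
      congr 1
      · simp [Polynomial.coeff_X_pow, apply_ite star]
      · refine Finset.sum_congr rfl fun m _ => ?_
        rw [ih m m.2, hX, formR_conjCoeff, ← hX, Polynomial.coeff_mul_C, Polynomial.coeff_C_mul,
          coeff_conjCoeff, star_mul]
    rw [psiR, psiL]
    simp only [hv, formR_conjCoeff, Quaternion.re_star]
    ext1 k
    simp only [coeff_conjCoeff, Polynomial.coeff_smul, Quaternion.star_smul]

theorem evalR_eq_eval (φ : ℍ[ℝ][X]) (p : ℍ[ℝ]) : evalR φ p = φ.eval p := by
  rw [Polynomial.eval_eq_sum_range, evalR]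

theorem evalL_eq_star_eval (φ : ℍ[ℝ][X]) (p : ℍ[ℝ]) :
    evalL φ p = star ((conjCoeff φ).eval (star p)) := by
  rw [Polynomial.eval_eq_sum_range, evalL, natDegree_conjCoeff, star_sum]
  simp [coeff_conjCoeff]

theorem conjCoeff_rev (φ : ℍ[ℝ][X]) : conjCoeff (rev φ) = φ.reverse := by
  ext1 k
  rw [coeff_conjCoeff, coeff_rev, Polynomial.coeff_reverse]
  split_ifs with h
  · rw [star_star, Polynomial.revAt_le h]
  · rw [star_zero, Polynomial.revAt_eq_self_of_lt (not_le.1 h),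
      Polynomial.coeff_eq_zero_of_natDegree_lt (not_le.1 h)]

/-! ### The orthonormal polynomials in terms of the Szegő recursion -/

theorem isMonicOrthogonal_szego (hc : IsNontrivialPositive c) :
    IsMonicOrthogonal c (szego (verblunsky c)) (sqNorm c (verblunsky c)) where
  natDegree_le n := (natDegree_szego _ n).le
  coeff_self n := coeff_szego_self _ n
  pairing_eq_zero n := (szegoOrthogonal_verblunsky hc n).1.szego
  pairing_self n := (szegoOrthogonal_verblunsky hc n).1.szego_self
  pos n := sqNorm_verblunsky_pos hc n

theorem coeff_reflect_of_natDegree_le {φ : ℍ[ℝ][X]} {n : ℕ} (hφ : φ.natDegree ≤ n) (k : ℕ) :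
    (Polynomial.reflect n φ).coeff k = if k ≤ n then φ.coeff (n - k) else 0 := by
  rw [Polynomial.coeff_reflect]
  split_ifs with h
  · rw [Polynomial.revAt_le h]
  · rw [Polynomial.revAt_eq_self_of_lt (not_le.1 h),
      Polynomial.coeff_eq_zero_of_natDegree_lt (hφ.trans_lt (not_le.1 h))]

theorem natDegree_reflect_le_of_natDegree_le {φ : ℍ[ℝ][X]} {n : ℕ} (hφ : φ.natDegree ≤ n) :
    (Polynomial.reflect n φ).natDegree ≤ n :=
  Polynomial.natDegree_le_iff_coeff_eq_zero.2 fun k hk => by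
    rw [coeff_reflect_of_natDegree_le hφ, if_neg (not_le.2 hk)]

/-- Reflection turns orthogonality to `X, …, X^n` with respect to `c` into orthogonality to
`1, …, X^{n-1}` with respect to `conj c`. -/
theorem pairing_star_reflect (hs : ∀ n, star (c n) = c (-n)) {φ : ℍ[ℝ][X]} {n : ℕ}
    (hφ : φ.natDegree ≤ n) (l : ℤ) :
    pairing (fun n => star (c n)) l (Polynomial.reflect n φ) = pairing c (n - l) φ := by
  rw [pairing_eq_sum_range _ _ (natDegree_reflect_le_of_natDegree_le hφ), pairing_eq_sum_range _ _ hφ,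
    ← Finset.sum_range_reflect]
  refine Finset.sum_congr rfl fun k hk => ?_
  have hk' : k ≤ n := by simp only [Finset.mem_range] at hk; omega
  rw [show n + 1 - 1 - k = n - k by omega, coeff_reflect_of_natDegree_le hφ, if_pos (by omega),
    Nat.sub_sub_self hk', hs]
  congr 2
  omega

theorem isMonicOrthogonal_reflect_szegoStar (hc : IsNontrivialPositive c) :
    IsMonicOrthogonal (fun n => star (c n))
      (fun n => Polynomial.reflect n (szegoStar (verblunsky c) n))
      (sqNorm c (verblunsky c)) where
  natDegree_le n := natDegree_reflect_le_of_natDegree_le (natDegree_szego_le _ n).2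
  coeff_self n := by
    rw [coeff_reflect_of_natDegree_le (natDegree_szego_le _ n).2, if_pos le_rfl, Nat.sub_self,
      coeff_szegoStar_zero]
  pairing_eq_zero n l hl := by
    rw [pairing_star_reflect hc.star_eq (natDegree_szego_le _ n).2,
      ← (szegoOrthogonal_verblunsky hc n).1.szegoStar (n - 1 - l) (by omega)]
    congr 2
    omega
  pairing_self n := by
    rw [pairing_star_reflect hc.star_eq (natDegree_szego_le _ n).2, sub_self]
    exact (szegoOrthogonal_verblunsky hc n).1.szegoStar_zero
  pos n := sqNorm_verblunsky_pos hc n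

theorem psiL_eq_szego (hc : IsNontrivialPositive c) (n : ℕ) :
    psiL c n = (Real.sqrt (sqNorm c (verblunsky c) n))⁻¹ • szego (verblunsky c) n :=
  (isMonicOrthogonal_szego hc).psiL_eq hc.star_eq n

theorem conjCoeff_psiR (hc : IsNontrivialPositive c) (n : ℕ) :
    conjCoeff (psiR c n) = (Real.sqrt (sqNorm c (verblunsky c) n))⁻¹ •
      Polynomial.reflect n (szegoStar (verblunsky c) n) := by
  rw [psiR_eq_conjCoeff, conjCoeff_conjCoeff]
  exact (isMonicOrthogonal_reflect_szegoStar hc).psiL_eq (fun n => by simp only [hc.star_eq]) n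

/-- The Szegő recursion for the reflected polynomials, which are the right orthogonal polynomials
with conjugated coefficients. -/
theorem reflect_szegoStar_succ (γ : ℕ → ℍ[ℝ]) (n : ℕ) :
    Polynomial.reflect (n + 1) (szegoStar γ (n + 1)) =
      Polynomial.reflect n (szegoStar γ n) * Polynomial.X -
        Polynomial.C (γ n) * Polynomial.reflect n (szego γ n) := by
  have h1 := natDegree_szego_le γ n
  ext1 k
  rw [coeff_reflect_of_natDegree_le (natDegree_szego_le γ (n + 1)).2, Polynomial.coeff_sub,
    Polynomial.coeff_C_mul, coeff_reflect_of_natDegree_le h1.1, szegoStar_succ,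
    Polynomial.coeff_sub, Polynomial.coeff_C_mul]
  cases k with
  | zero =>
    simp [Polynomial.coeff_eq_zero_of_natDegree_lt (Nat.lt_succ_of_le h1.2)]
  | succ k =>
    rw [Polynomial.coeff_mul_X, coeff_reflect_of_natDegree_le h1.2]
    rcases lt_trichotomy k n with hk | rfl | hk
    · obtain ⟨m, rfl⟩ : ∃ m, n = k + 1 + m := ⟨n - (k + 1), by omega⟩
      rw [if_pos (by omega), if_pos (by omega), if_pos (by omega),
        show k + 1 + m + 1 - (k + 1) = m + 1 by omega, show k + 1 + m - k = m + 1 by omega,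
        show k + 1 + m - (k + 1) = m by omega, Polynomial.coeff_X_mul]
    · simp
    · rw [if_neg (by omega), if_neg (by omega), if_neg (by omega)]
      simp

/-- The square roots in the normalisation: `r_n / √E_{n+1} = 1 / √E_n`. -/
theorem sqrt_mul_inv_sqrt_sqNorm_succ (hc : IsNontrivialPositive c) (n : ℕ) :
    Real.sqrt (1 - ‖verblunsky c n‖ ^ 2) * (Real.sqrt (sqNorm c (verblunsky c) (n + 1)))⁻¹ =
      (Real.sqrt (sqNorm c (verblunsky c) n))⁻¹ := by
  have h1 : 0 < 1 - ‖verblunsky c n‖ ^ 2 := by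
    rw [sub_pos, sq_lt_one_iff₀ (norm_nonneg _)]
    exact norm_verblunsky_lt_one hc n
  have h2 := Real.sqrt_pos.2 h1
  rw [sqNorm_succ, Real.sqrt_mul (sqNorm_verblunsky_pos hc n).le, mul_inv, mul_comm, mul_assoc,
    inv_mul_cancel₀ h2.ne', mul_one]

theorem rev_psiR (hc : IsNontrivialPositive c) (n : ℕ) :
    rev (psiR c n) = (Real.sqrt (sqNorm c (verblunsky c) n))⁻¹ • szegoStar (verblunsky c) n := by
  have hs : (Real.sqrt (sqNorm c (verblunsky c) n))⁻¹ ≠ 0 :=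
    (inv_pos.2 (Real.sqrt_pos.2 (sqNorm_verblunsky_pos hc n))).ne'
  have hdeg : (psiR c n).natDegree = n := by
    have h := isMonicOrthogonal_reflect_szegoStar hc
    rw [← natDegree_conjCoeff, conjCoeff_psiR hc]
    refine le_antisymm ((Polynomial.natDegree_smul_le _ _).trans (h.natDegree_le n))
      (Polynomial.le_natDegree_of_ne_zero ?_)
    rw [Polynomial.coeff_smul, h.coeff_self]
    exact smul_ne_zero hs one_ne_zero
  ext1 k
  rw [coeff_rev, hdeg, ← coeff_conjCoeff, conjCoeff_psiR hc, Polynomial.coeff_smul,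
    Polynomial.coeff_smul, coeff_reflect_of_natDegree_le (natDegree_szego_le _ n).2,
    if_pos (Nat.sub_le n k)]
  split_ifs with h
  · rw [Nat.sub_sub_self h]
  · rw [Polynomial.coeff_eq_zero_of_natDegree_lt
      ((natDegree_szego_le _ n).2.trans_lt (not_le.1 h)), smul_zero]

theorem conjCoeff_rev_psiL (hc : IsNontrivialPositive c) (n : ℕ) :
    conjCoeff (rev (psiL c n)) = (Real.sqrt (sqNorm c (verblunsky c) n))⁻¹ •
      Polynomial.reflect n (szego (verblunsky c) n) := by
  have hs : (((Real.sqrt (sqNorm c (verblunsky c) n))⁻¹ : ℝ) : ℍ[ℝ]) ≠ 0 := by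
    rw [← Quaternion.coe_zero, Ne, Quaternion.coe_inj]
    exact (inv_pos.2 (Real.sqrt_pos.2 (sqNorm_verblunsky_pos hc n))).ne'
  have hdeg : (psiL c n).natDegree = n := by
    rw [psiL_eq_szego hc, real_smul_eq_C_mul, Polynomial.natDegree_C_mul hs, natDegree_szego]
  rw [conjCoeff_rev, Polynomial.reverse, hdeg, psiL_eq_szego hc, real_smul_eq_C_mul,
    real_smul_eq_C_mul, Polynomial.reflect_C_mul]

end QuatOPUC

end

theorem mainTheorem3 (i j : Quaternion ℝ)
    (hi : i ∈ QuatOPUC.imagUnits) (hj : j ∈ QuatOPUC.imagUnits) (hij : inner ℝ i j = 0)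
    (μ : MeasureTheory.VectorMeasure (QuatOPUC.sliceCircle i) (Quaternion ℝ))
    (hμ : QuatOPUC.IsQPositive i j μ)
    (hnt : QuatOPUC.IsNontrivialPositive (QuatOPUC.moment μ))
    (γ : ℕ → Quaternion ℝ) (hγ : γ = QuatOPUC.verblunsky (QuatOPUC.moment μ))
    (ψL ψR : ℕ → Polynomial (Quaternion ℝ))
    (hψL : ψL = QuatOPUC.psiL (QuatOPUC.moment μ)) (hψR : ψR = QuatOPUC.psiR (QuatOPUC.moment μ))
    (r : ℕ → ℝ) (hr : ∀ n, r n = Real.sqrt (1 - ‖γ n‖ ^ 2)) :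
    ∀ n : ℕ, ‖γ n‖ < 1 ∧
      (∀ p : Quaternion ℝ,
        QuatOPUC.evalR (ψL n) p * p - (r n : Quaternion ℝ) * QuatOPUC.evalR (ψL (n + 1)) p =
          star (γ n) * QuatOPUC.evalR (QuatOPUC.rev (ψR n)) p) ∧
      (∀ p : Quaternion ℝ,
        p * QuatOPUC.evalL (ψR n) p - QuatOPUC.evalL (ψR (n + 1)) p * (r n : Quaternion ℝ) =
          QuatOPUC.evalL (QuatOPUC.rev (ψL n)) p * star (γ n)) := by
  subst hγ hψL hψR
  intro n
  have hs := QuatOPUC.sqrt_mul_inv_sqrt_sqNorm_succ hnt n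
  rw [← hr n] at hs
  refine ⟨QuatOPUC.norm_verblunsky_lt_one hnt n, fun p => ?_, fun p => ?_⟩
  · rw [QuatOPUC.psiL_eq_szego hnt, QuatOPUC.psiL_eq_szego hnt, QuatOPUC.rev_psiR hnt]
    simp only [QuatOPUC.evalR_eq_eval, Polynomial.eval_smul, Quaternion.coe_mul_eq_smul, smul_smul,
      hs, QuatOPUC.szego_succ, Polynomial.X_mul, Polynomial.eval_sub, Polynomial.eval_mul_X,
      Polynomial.eval_C_mul, smul_sub, smul_mul_assoc, mul_smul_comm, sub_sub_cancel]
  · rw [← star_inj]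
    simp only [QuatOPUC.evalL_eq_star_eval, star_sub, star_mul, star_star, Quaternion.star_coe,
      QuatOPUC.conjCoeff_psiR hnt, QuatOPUC.conjCoeff_rev_psiL hnt, Polynomial.eval_smul,
      Quaternion.coe_mul_eq_smul, smul_smul, hs, QuatOPUC.reflect_szegoStar_succ,
      Polynomial.eval_sub, Polynomial.eval_mul_X, Polynomial.eval_C_mul, smul_sub, smul_mul_assoc,
      mul_smul_comm, sub_sub_cancel]
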